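/- Let $M$ be a 2-dimensional smooth manifold (connected, Hausdorff, second countable) and let $F:TM\to\mathbb{R}$ be a positive definite Finsler function: $F$ is smooth on the slit tangent bundle $\mathring{T}M=TM\setminus o(M)$, $F(\lambda v)=\lambda F(v)$ for all $v\in TM$ and $\lambda\ge 0$, the metric tensor $g_{ij}=\partial^2E/\partial y^i\partial y^j$ of the energy $E=\tfrac12F^2$ is non-degenerate on $\mathring{T}M$, and $F(v)>0$ for $v\in\mathring{T}M$. In the coordinates $(x^i,y^i)$ of $TM$ induced by a chart of $M$, let $$G^i=\tfrac12 g^{ij}\Big(y^r\frac{\partial^2E}{\partial x^r\partial y^j}-\frac{\partial E}{\partial x^j}\Big),\qquad N^i_j=\frac{\partial G^i}{\partial y^j},\qquad \Gamma^i_{jk}=\frac{\partial N^i_j}{\partial y^k}$$ be the coefficients of the canonical spray $S=y^i\frac{\partial}{\partial x^i}-2G^i\frac{\partial}{\partial y^i}$, of the canonical connection and of the horizontal Berwald derivative $\nabla^{\mathsf h}$, let $\mathbf{B}$ be the Berwald curvature, with components $B^i_{jkl}=\partial\Gamma^i_{kl}/\partial y^j$, and let $\mathbf{P}=-\tfrac12\nabla^{\mathsf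 h}g$ be the Landsberg tensor, $$P_{jkl}=-\tfrac12\Big(\frac{\partial g_{kl}}{\partial x^j}-N^r_j\frac{\partial g_{kl}}{\partial y^r}-\Gamma^r_{jk}g_{rl}-\Gamma^r_{jl}g_{kr}\Big).$$ Let $\delta=y^i\partial_i$ be the canonical section and $\mathbf{p}(X)=X-\frac{g(X,\delta)}{g(\delta,\delta)}\delta$ the orthogonal projection along $\delta$. The Finsler manifold $(M,F)$ is called a Berwald manifold if $\mathbf{B}=0$, weakly Berwald if the trace $B^i_{ikl}$ of $\mathbf{B}$ vanishes, and p-Berwald if the projected tensor $\mathbf{p}(\mathbf{B}(\mathbf{p}X,\mathbf{p}Y)\mathbf{p}Z)$ vanishes (all conditions on $\mathring{T}M$). Then: 1. $(M,F)$ is weakly Berwald if and only if it is p-Berwald. 2. $(M,F)$ is a Berwald manifold if and only if it is weakly Berwald and $\mathbf{P}=0$. 3. $(M,F)$ is a Berwald manifold if and only if it is p-Berwald and $\mathbf{P}=0$. -/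

import Mathlib

open scoped Manifold ContDiff

noncomputable section

namespace Finsler

variable {n : ℕ}

/-! ### Local tensor calculus

Functions of `(x, y)`, where `x` is the position and `y` the direction, both with `n` coordinates.
The letter `E` stands for the energy function in these coordinates. -/

/-- The coordinate space `ℝⁿ`. -/
abbrev Coord (n : ℕ) : Type := EuclideanSpace ℝ (Fin n)

/-- The partial derivative `∂φ/∂xⁱ` (position). -/
def dPos (i : Fin n) (φ : Coord n → Coord n → ℝ) (x y : Coord n) : ℝ :=
  fderiv ℝ (fun x' => φ x' y) x (EuclideanSpace.single i 1)

/-- The partial derivative `∂φ/∂yⁱ` (direction). -/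
def dDir (i : Fin n) (φ : Coord n → Coord n → ℝ) (x y : Coord n) : ℝ :=
  fderiv ℝ (fun y' => φ x y') y (EuclideanSpace.single i 1)

/-- The metric tensor `g_ij = ∂²E/∂yⁱ∂yʲ`. -/
def metric (E : Coord n → Coord n → ℝ) (i j : Fin n) (x y : Coord n) : ℝ :=
  dDir i (dDir j E) x y

/-- The matrix `(g_ij)` of the metric tensor. -/
def metricMatrix (E : Coord n → Coord n → ℝ) (x y : Coord n) : Matrix (Fin n) (Fin n) ℝ :=
  Matrix.of fun i j => metric E i j x y

/-- The coefficients
`Gⁱ = ½ gⁱʲ (yʳ ∂²E/∂xʳ∂yʲ - ∂E/∂xʲ)` of the canonical spray `S = yⁱ ∂/∂xⁱ - 2 Gⁱ ∂/∂yⁱ`,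
the solution of `i_S d d_J E = -dE`. -/
def sprayCoeff (E : Coord n → Coord n → ℝ) (i : Fin n) (x y : Coord n) : ℝ :=
  (1 / 2) * ∑ j, (metricMatrix E x y)⁻¹ i j *
    ((∑ r, y r * dPos r (dDir j E) x y) - dPos j E x y)

/-- The coefficients `Nⁱⱼ = ∂Gⁱ/∂yʲ` of the canonical (Ehresmann) connection: the horizontal lift
of `∂/∂xʲ` is `½ ((∂ⱼ)ᶜ + [(∂ⱼ)ᵛ, S]) = ∂/∂xʲ - Nⁱⱼ ∂/∂yⁱ`. -/
def connCoeff (E : Coord n → Coord n → ℝ) (i j : Fin n) (x y : Coord n) : ℝ :=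
  dDir j (sprayCoeff E i) x y

/-- The Christoffel symbols `Γⁱⱼₖ = ∂Nⁱⱼ/∂yᵏ` of the horizontal Berwald derivative:
the `i`-th component of `∇ʰ_{∂ⱼ} ∂ₖ`, the bracket of the horizontal lift of `∂ⱼ` with the vertical
lift of `∂ₖ`. -/
def berwaldCoeff (E : Coord n → Coord n → ℝ) (i j k : Fin n) (x y : Coord n) : ℝ :=
  dDir k (connCoeff E i j) x y

/-- The Berwald curvature: `berwaldCurv E i j k l` is the `i`-th component of `B(∂ⱼ, ∂ₖ)∂ₗ`, the
mixed (vertical-horizontal) curvature of the Berwald derivative, which is `∂Γⁱₖₗ/∂yʲ`. -/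
def berwaldCurv (E : Coord n → Coord n → ℝ) (i j k l : Fin n) (x y : Coord n) : ℝ :=
  dDir j (berwaldCoeff E i k l) x y

/-- The trace of the Berwald curvature, over the contravariant and the first covariant index. -/
def berwaldTrace (E : Coord n → Coord n → ℝ) (k l : Fin n) (x y : Coord n) : ℝ :=
  ∑ i, berwaldCurv E i i k l x y

/-- The components `(∇ʰ g)(∂ⱼ, ∂ₖ, ∂ₗ)` of the horizontal Berwald differential of the metric. -/
def horizMetric (E : Coord n → Coord n → ℝ) (j k l : Fin n) (x y : Coord n) : ℝ :=
  (dPos j (metric E k l) x y - ∑ r, connCoeff E r j x y * dDir r (metric E k l) x y)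
    - (∑ r, berwaldCoeff E r j k x y * metric E r l x y)
    - ∑ r, berwaldCoeff E r j l x y * metric E k r x y

/-- The Landsberg tensor `P = -½ ∇ʰ g`. -/
def landsberg (E : Coord n → Coord n → ℝ) (j k l : Fin n) (x y : Coord n) : ℝ :=
  -(1 / 2) * horizMetric E j k l x y

/-- The orthogonal projection `p(X) = X - (g(X, δ) / g(δ, δ)) δ` along the canonical section
`δ = yⁱ ∂ᵢ`: `orthProj E i j` is the `i`-th component of `p(∂ⱼ)`. -/
def orthProj (E : Coord n → Coord n → ℝ) (i j : Fin n) (x y : Coord n) : ℝ :=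
  (if i = j then 1 else 0)
    - (∑ a, metric E j a x y * y a) / (∑ a, ∑ b, metric E a b x y * y a * y b) * y i

/-- The projected Berwald curvature `p(B(pX, pY)pZ)`. -/
def projBerwaldCurv (E : Coord n → Coord n → ℝ) (i j k l : Fin n) (x y : Coord n) : ℝ :=
  ∑ a, ∑ b, ∑ c, ∑ d, orthProj E i a x y * berwaldCurv E a b c d x y *
    orthProj E b j x y * orthProj E c k x y * orthProj E d l x y

/-! ### Finsler manifolds -/

variable {M : Type*} [TopologicalSpace M] [ChartedSpace (Coord n) M]

/-- The energy function `½ F²` in the coordinates on `TM` induced by a chart `e` of `M`: the pair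
`(x, y)` stands for the tangent vector `yⁱ ∂ᵢ` at the point with coordinates `x`. -/
def localEnergy (F : TangentBundle (𝓡 n) M → ℝ) (e : OpenPartialHomeomorph M (Coord n))
    (x y : Coord n) : ℝ :=
  (1 / 2) * F (tangentMap (𝓡 n) (𝓡 n) e.symm ⟨x, y⟩) ^ 2

/-- `ForallCoord F T` says that `T`, a property of a local energy function at `(x, y)`, holds for the
local energy functions of `F` in every chart of the smooth structure of `M`, at every point of the
slit tangent bundle over the chart. -/
def ForallCoord (F : TangentBundle (𝓡 n) M → ℝ)
    (T : (Coord n → Coord n → ℝ) → Coord n → Coord n → Prop) : Prop :=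
  ∀ e ∈ IsManifold.maximalAtlas (𝓡 n) ∞ M, ∀ x ∈ e.target, ∀ y : Coord n, y ≠ 0 →
    T (localEnergy F e) x y

/-- Finsler functions: smooth on the slit tangent bundle, positive-homogeneous of degree `1`, with
fibrewise non-degenerate metric tensor. -/
structure IsFinslerFunction [IsManifold (𝓡 n) ∞ M] (F : TangentBundle (𝓡 n) M → ℝ) :
    Prop where
  smooth : ContMDiffOn (𝓡 n).tangent 𝓘(ℝ, ℝ) ∞ F {v | v.2 ≠ 0}
  homogeneous : ∀ (p : M) (v : TangentSpace (𝓡 n) p) (c : ℝ), 0 ≤ c → F ⟨p, c • v⟩ = c * F ⟨p, v⟩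
  nondegenerate : ForallCoord F fun E x y => (metricMatrix E x y).det ≠ 0

/-- A Finsler function is positive definite if it is positive on nonzero tangent vectors. -/
def IsPositiveDefinite (F : TangentBundle (𝓡 n) M → ℝ) : Prop :=
  ∀ v : TangentBundle (𝓡 n) M, v.2 ≠ 0 → 0 < F v

/-- Berwald manifolds: the Berwald curvature vanishes. -/
def IsBerwald (F : TangentBundle (𝓡 n) M → ℝ) : Prop :=
  ForallCoord F fun E x y => ∀ i j k l, berwaldCurv E i j k l x y = 0

/-- Weakly Berwald manifolds: the Berwald curvature is traceless. -/
def IsWeaklyBerwald (F : TangentBundle (𝓡 n) M → ℝ) : Prop :=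
  ForallCoord F fun E x y => ∀ k l, berwaldTrace E k l x y = 0

/-- p-Berwald manifolds: the projected Berwald curvature vanishes. -/
def IsPBerwald (F : TangentBundle (𝓡 n) M → ℝ) : Prop :=
  ForallCoord F fun E x y => ∀ i j k l, projBerwaldCurv E i j k l x y = 0

/-- The Landsberg tensor vanishes. -/
def HasVanishingLandsberg (F : TangentBundle (𝓡 n) M → ℝ) : Prop :=
  ForallCoord F fun E x y => ∀ j k l, landsberg E j k l x y = 0

end Finsler

end

namespace Finsler

variable {n : ℕ}

/-! Everything is pointwise in a chart. The components B^i_{jkl} are third y-derivatives of the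
spray coefficients G^i, hence symmetric in j, k, l, and since G^i has degree 2, Euler's theorem
gives y^j B^i_{jkl} = 0. In dimension two this forces B^i_{jkl} = b^i m_j m_k m_l with m = (-y¹,
y⁰), the covector annihilating y (`exists_berwaldCurv_eq`).

The trace is m(b) m_k m_l, and m is nonzero, so it vanishes exactly when b is a multiple of y. Since
m kills the canonical section, m ∘ p = m, so the projected curvature is p(b) m_j m_k m_l; it too
vanishes exactly when b is a multiple of y, because g(δ, δ) = 2E ≠ 0. This is statement 1.

For statement 2, the canonical connection preserves the energy: (∂E/∂y^i) N^i_k = ∂E/∂x^k. Two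
y-derivatives of this identity give ∇ʰg = (∂E/∂y^i) B^i (`horizMetric_eq`). If b = c y, Euler's
theorem turns P into -c E m_j m_k m_l, so P = 0 forces c = 0. Statement 3 combines the other two. -/

/-- Smoothness in `(x, y)` for `x ∈ U` and `y ≠ 0`. -/
def SmoothSlit (U : Set (Coord n)) (φ : Coord n → Coord n → ℝ) : Prop :=
  ContDiffOn ℝ ∞ (Function.uncurry φ) (U ×ˢ {0}ᶜ)

/-- Positive homogeneity of degree `k` in the direction, over `U`. -/
def HomogeneousOn (k : ℕ) (U : Set (Coord n)) (φ : Coord n → Coord n → ℝ) : Prop :=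
  ∀ x ∈ U, ∀ y : Coord n, y ≠ 0 → ∀ c : ℝ, 0 < c → φ x (c • y) = c ^ k * φ x y

/-! ### Partial derivatives and homogeneity off the zero section -/

section Calculus

variable {U : Set (Coord n)} {φ ψ : Coord n → Coord n → ℝ} {x y : Coord n}

lemma isOpen_slit (hU : IsOpen U) : IsOpen (U ×ˢ ({0}ᶜ : Set (Coord n))) :=
  hU.prod isOpen_compl_singleton

lemma SmoothSlit.contDiffAt (hφ : SmoothSlit U φ) (hU : IsOpen U) (hx : x ∈ U) (hy : y ≠ 0) :
    ContDiffAt ℝ ∞ (Function.uncurry φ) (x, y) :=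
  ContDiffOn.contDiffAt hφ ((isOpen_slit hU).mem_nhds ⟨hx, hy⟩)

lemma SmoothSlit.differentiableAt (hφ : SmoothSlit U φ) (hU : IsOpen U) (hx : x ∈ U)
    (hy : y ≠ 0) : DifferentiableAt ℝ (Function.uncurry φ) (x, y) :=
  (hφ.contDiffAt hU hx hy).differentiableAt (by simp)

lemma SmoothSlit.differentiableAt_dir (hφ : SmoothSlit U φ) (hU : IsOpen U) (hx : x ∈ U)
    (hy : y ≠ 0) : DifferentiableAt ℝ (fun y' => φ x y') y :=
  (hφ.differentiableAt hU hx hy).comp (f := fun y' => (x, y')) y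
    ((differentiableAt_const x).prodMk differentiableAt_id)

/-- Passing to the total derivative on the product makes smoothness and the symmetry of second
derivatives available for iterated partial derivatives. -/
lemma SmoothSlit.dDir_eq (hφ : SmoothSlit U φ) (hU : IsOpen U) (hx : x ∈ U) (hy : y ≠ 0)
    (i : Fin n) : dDir i φ x y =
      fderiv ℝ (Function.uncurry φ) (x, y) (0, EuclideanSpace.single i 1) := by
  have h := (hφ.differentiableAt hU hx hy).hasFDerivAt.comp y
    ((hasFDerivAt_const x y).prodMk (hasFDerivAt_id y))
  exact DFunLike.congr_fun h.fderiv (EuclideanSpace.single i 1)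

lemma SmoothSlit.dPos_eq (hφ : SmoothSlit U φ) (hU : IsOpen U) (hx : x ∈ U) (hy : y ≠ 0)
    (i : Fin n) : dPos i φ x y =
      fderiv ℝ (Function.uncurry φ) (x, y) (EuclideanSpace.single i 1, 0) := by
  have h := (hφ.differentiableAt hU hx hy).hasFDerivAt.comp (f := fun x' => (x', y)) x
    ((hasFDerivAt_id x).prodMk (hasFDerivAt_const y x))
  exact DFunLike.congr_fun h.fderiv (EuclideanSpace.single i 1)

lemma contDiffOn_fderiv_slit (hφ : SmoothSlit U φ) (hU : IsOpen U) (v : Coord n × Coord n) :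
    ContDiffOn ℝ ∞ (fun p => fderiv ℝ (Function.uncurry φ) p v) (U ×ˢ {0}ᶜ) :=
  (ContDiffOn.fderiv_of_isOpen hφ (isOpen_slit hU) (by simp)).clm_apply contDiffOn_const

lemma SmoothSlit.dDir (hφ : SmoothSlit U φ) (hU : IsOpen U) (i : Fin n) :
    SmoothSlit U (dDir i φ) :=
  (contDiffOn_fderiv_slit hφ hU _).congr fun _ hp => hφ.dDir_eq hU hp.1 hp.2 i

lemma SmoothSlit.dPos (hφ : SmoothSlit U φ) (hU : IsOpen U) (i : Fin n) :
    SmoothSlit U (dPos i φ) :=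
  (contDiffOn_fderiv_slit hφ hU _).congr fun _ hp => hφ.dPos_eq hU hp.1 hp.2 i

lemma fderiv_fderiv_comm {f : Coord n × Coord n → ℝ} {p : Coord n × Coord n}
    (hf : ContDiffAt ℝ ∞ f p) (v w : Coord n × Coord n) :
    fderiv ℝ (fun q => fderiv ℝ f q v) p w = fderiv ℝ (fun q => fderiv ℝ f q w) p v := by
  have hd : DifferentiableAt ℝ (fderiv ℝ f) p :=
    (hf.fderiv_right (m := ∞) (by simp)).differentiableAt (by simp)
  have hs : IsSymmSndFDerivAt ℝ f p := (contDiffAt_infty.1 hf 2).isSymmSndFDerivAt (by simp)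
  rw [fderiv_clm_apply hd (differentiableAt_const v),
    fderiv_clm_apply hd (differentiableAt_const w)]
  simpa using hs w v

lemma dDir_dDir_comm (hφ : SmoothSlit U φ) (hU : IsOpen U) (hx : x ∈ U) (hy : y ≠ 0)
    (i j : Fin n) : dDir i (dDir j φ) x y = dDir j (dDir i φ) x y := by
  have key (k : Fin n) : Function.uncurry (Finsler.dDir k φ) =ᶠ[nhds (x, y)]
      fun q => fderiv ℝ (Function.uncurry φ) q (0, EuclideanSpace.single k 1) := by
    filter_upwards [(isOpen_slit hU).mem_nhds ⟨hx, hy⟩] with q hq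
    exact hφ.dDir_eq hU hq.1 hq.2 k
  rw [(hφ.dDir hU j).dDir_eq hU hx hy, (hφ.dDir hU i).dDir_eq hU hx hy, (key j).fderiv_eq,
    (key i).fderiv_eq]
  exact fderiv_fderiv_comm (hφ.contDiffAt hU hx hy) _ _

lemma dDir_dPos_comm (hφ : SmoothSlit U φ) (hU : IsOpen U) (hx : x ∈ U) (hy : y ≠ 0)
    (i j : Fin n) : dDir i (dPos j φ) x y = dPos j (dDir i φ) x y := by
  have h₁ : Function.uncurry (Finsler.dPos j φ) =ᶠ[nhds (x, y)]
      fun q => fderiv ℝ (Function.uncurry φ) q (EuclideanSpace.single j 1, 0) := by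
    filter_upwards [(isOpen_slit hU).mem_nhds ⟨hx, hy⟩] with q hq
    exact hφ.dPos_eq hU hq.1 hq.2 j
  have h₂ : Function.uncurry (Finsler.dDir i φ) =ᶠ[nhds (x, y)]
      fun q => fderiv ℝ (Function.uncurry φ) q (0, EuclideanSpace.single i 1) := by
    filter_upwards [(isOpen_slit hU).mem_nhds ⟨hx, hy⟩] with q hq
    exact hφ.dDir_eq hU hq.1 hq.2 i
  rw [(hφ.dPos hU j).dDir_eq hU hx hy, (hφ.dDir hU i).dPos_eq hU hx hy, h₁.fderiv_eq,
    h₂.fderiv_eq]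
  exact fderiv_fderiv_comm (hφ.contDiffAt hU hx hy) _ _

/-- The slit fibre is open, so an identity at a fixed `x`, valid for all nonzero directions, may be
differentiated in the direction. -/
lemma dDir_congr (h : ∀ y, y ≠ 0 → φ x y = ψ x y) (hy : y ≠ 0) (i : Fin n) :
    dDir i φ x y = dDir i ψ x y := by
  have : (fun y' => φ x y') =ᶠ[nhds y] fun y' => ψ x y' := by
    filter_upwards [isOpen_compl_singleton.mem_nhds hy] with y' hy' using h y' hy'
  simp only [dDir, this.fderiv_eq]

lemma SmoothSlit.mul (hφ : SmoothSlit U φ) (hψ : SmoothSlit U ψ) :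
    SmoothSlit U fun x y => φ x y * ψ x y :=
  ContDiffOn.mul hφ hψ

lemma SmoothSlit.sub (hφ : SmoothSlit U φ) (hψ : SmoothSlit U ψ) :
    SmoothSlit U fun x y => φ x y - ψ x y :=
  ContDiffOn.sub hφ hψ

lemma smoothSlit_const (c : ℝ) : SmoothSlit U fun _ _ => c :=
  contDiffOn_const

lemma SmoothSlit.sum {ι : Type*} {s : Finset ι} {φ : ι → Coord n → Coord n → ℝ}
    (hφ : ∀ i ∈ s, SmoothSlit U (φ i)) : SmoothSlit U fun x y => ∑ i ∈ s, φ i x y :=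
  ContDiffOn.sum hφ

lemma SmoothSlit.prod {ι : Type*} {s : Finset ι} {φ : ι → Coord n → Coord n → ℝ}
    (hφ : ∀ i ∈ s, SmoothSlit U (φ i)) : SmoothSlit U fun x y => ∏ i ∈ s, φ i x y :=
  contDiffOn_prod hφ

lemma smoothSlit_coord (i : Fin n) : SmoothSlit U fun _ y => y i :=
  ((EuclideanSpace.proj (𝕜 := ℝ) i).contDiff.comp contDiff_snd).contDiffOn

lemma SmoothSlit.det {ι : Type*} [Fintype ι] [DecidableEq ι]
    {A : Coord n → Coord n → Matrix ι ι ℝ} (hA : ∀ i j, SmoothSlit U fun x y => A x y i j) :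
    SmoothSlit U fun x y => (A x y).det := by
  simp only [Matrix.det_apply']
  exact SmoothSlit.sum fun σ _ =>
    (smoothSlit_const _).mul (SmoothSlit.prod fun i _ => hA (σ i) i)

/-- Cramer's rule: the inverse is the adjugate, polynomial in the entries, divided by the
determinant. -/
lemma SmoothSlit.matrix_inv {ι : Type*} [Fintype ι] [DecidableEq ι]
    {A : Coord n → Coord n → Matrix ι ι ℝ} (hA : ∀ i j, SmoothSlit U fun x y => A x y i j)
    (hdet : ∀ x ∈ U, ∀ y, y ≠ 0 → (A x y).det ≠ 0) (i j : ι) :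
    SmoothSlit U fun x y => (A x y)⁻¹ i j := by
  have hadj : SmoothSlit U fun x y => (A x y).adjugate i j := by
    simp only [Matrix.adjugate_apply]
    refine SmoothSlit.det fun k l => ?_
    by_cases hk : k = j
    · subst hk
      simpa using smoothSlit_const _
    · simpa [Matrix.updateRow_ne hk] using hA k l
  have hinv : SmoothSlit U fun x y => ((A x y).det)⁻¹ :=
    ContDiffOn.inv (SmoothSlit.det hA) fun p hp => hdet p.1 hp.1 p.2 hp.2
  simpa [Matrix.inv_def] using hinv.mul hadj

lemma dDir_mul (hφ : SmoothSlit U φ) (hψ : SmoothSlit U ψ) (hU : IsOpen U) (hx : x ∈ U)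
    (hy : y ≠ 0) (i : Fin n) : dDir i (fun x y => φ x y * ψ x y) x y =
      dDir i φ x y * ψ x y + φ x y * dDir i ψ x y := by
  simp only [dDir]
  rw [fderiv_fun_mul (hφ.differentiableAt_dir hU hx hy) (hψ.differentiableAt_dir hU hx hy)]
  simp
  ring

lemma dDir_add (hφ : SmoothSlit U φ) (hψ : SmoothSlit U ψ) (hU : IsOpen U) (hx : x ∈ U)
    (hy : y ≠ 0) (i : Fin n) : dDir i (fun x y => φ x y + ψ x y) x y =
      dDir i φ x y + dDir i ψ x y := by
  simp only [dDir]
  rw [fderiv_fun_add (hφ.differentiableAt_dir hU hx hy) (hψ.differentiableAt_dir hU hx hy)]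
  simp

lemma dDir_sum {ι : Type*} {s : Finset ι} {φ : ι → Coord n → Coord n → ℝ}
    (hφ : ∀ i, SmoothSlit U (φ i)) (hU : IsOpen U) (hx : x ∈ U) (hy : y ≠ 0) (i : Fin n) :
    dDir i (fun x y => ∑ j ∈ s, φ j x y) x y = ∑ j ∈ s, dDir i (φ j) x y := by
  simp only [dDir]
  rw [fderiv_fun_sum fun j _ => (hφ j).differentiableAt_dir hU hx hy]
  simp

lemma dDir_coord (i j : Fin n) :
    dDir i (fun _ y => y j) x y = if j = i then 1 else 0 := by
  have : HasFDerivAt (fun y' : Coord n => y' j) (EuclideanSpace.proj (𝕜 := ℝ) j) y :=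
    (EuclideanSpace.proj (𝕜 := ℝ) j).hasFDerivAt
  simp [dDir, this.fderiv]

lemma sum_coord_mul_dDir (φ : Coord n → Coord n → ℝ) (x y : Coord n) :
    ∑ i, y i * dDir i φ x y = fderiv ℝ (fun y' => φ x y') y y := by
  have h : ∑ i, y i • EuclideanSpace.single i (1 : ℝ) = y := by
    ext j
    simp [Pi.single_apply]
  conv_rhs => rw [← h, map_sum]
  simp only [h, map_smul, dDir, smul_eq_mul]

/-- Differentiating φ(x, c y) = c^(k+1) φ(x, y) in y produces a factor c on the left, which is then
cancelled. -/
lemma HomogeneousOn.dDir {k : ℕ} (hφ : HomogeneousOn (k + 1) U φ) (i : Fin n) :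
    HomogeneousOn k U (dDir i φ) := by
  intro x hx y hy c hc
  have h : Finsler.dDir i (fun x y => φ x (c • y)) x y =
      Finsler.dDir i (fun x y => c ^ (k + 1) * φ x y) x y :=
    dDir_congr (φ := fun x y => φ x (c • y)) (fun y hy => hφ x hx y hy c hc) hy i
  simp only [Finsler.dDir] at h ⊢
  have h₁ := fderiv_comp_smul (𝕜 := ℝ) (f := φ x) (x := y) c
  have h₂ := congrFun (fderiv_const_smul_field (𝕜 := ℝ) (f := φ x) (c ^ (k + 1))) y
  have h₃ : (fun y => c ^ (k + 1) * φ x y) = c ^ (k + 1) • φ x := rfl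
  rw [h₁, h₃, h₂] at h
  simp only [smul_apply, Pi.smul_apply, smul_eq_mul, pow_succ'] at h
  rw [mul_assoc] at h
  exact mul_left_cancel₀ hc.ne' h

lemma HomogeneousOn.dPos {k : ℕ} (hφ : HomogeneousOn k U φ) (hU : IsOpen U) (i : Fin n) :
    HomogeneousOn k U (dPos i φ) := by
  intro x hx y hy c hc
  have h : (fun x' => φ x' (c • y)) =ᶠ[nhds x] c ^ k • fun x' => φ x' y := by
    filter_upwards [hU.mem_nhds hx] with x' hx' using hφ x' hx' y hy c hc
  simp [Finsler.dPos, h.fderiv_eq, fderiv_const_smul_field]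

/-- Euler's theorem on homogeneous functions. -/
lemma HomogeneousOn.euler {k : ℕ} (hφ : HomogeneousOn k U φ) (hs : SmoothSlit U φ)
    (hU : IsOpen U) (hx : x ∈ U) (hy : y ≠ 0) :
    ∑ i, y i * Finsler.dDir i φ x y = k * φ x y := by
  rw [sum_coord_mul_dDir]
  have h₁ : HasDerivAt (fun c : ℝ => c • y) y 1 := by
    simpa using (hasDerivAt_id (1 : ℝ)).smul_const y
  have h₂ : HasFDerivAt (fun y' => φ x y') (fderiv ℝ (fun y' => φ x y') y) ((1 : ℝ) • y) := by
    simpa using (hs.differentiableAt_dir hU hx hy).hasFDerivAt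
  have h₃ := h₂.comp_hasDerivAt (1 : ℝ) h₁
  have h₄ : HasDerivAt (fun c : ℝ => c ^ k * φ x y) (k * φ x y) 1 := by
    simpa using (hasDerivAt_pow k (1 : ℝ)).mul_const (φ x y)
  refine h₃.unique (h₄.congr_of_eventuallyEq ?_)
  filter_upwards [lt_mem_nhds (zero_lt_one' ℝ)] with c hc using hφ x hx y hy c hc

end Calculus

/-! ### Spray, connection and Berwald curvature of an energy function -/

/-- A smooth energy function over `U`, positively homogeneous of degree `2` and regular. -/
structure IsRegularEnergy (U : Set (Coord n)) (E : Coord n → Coord n → ℝ) : Prop where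
  isOpen : IsOpen U
  smooth : SmoothSlit U E
  homogeneous : HomogeneousOn 2 U E
  det_ne_zero : ∀ x ∈ U, ∀ y, y ≠ 0 → (metricMatrix E x y).det ≠ 0

namespace IsRegularEnergy

variable {U : Set (Coord n)} {E : Coord n → Coord n → ℝ} {x y : Coord n}

lemma smooth_metric (h : IsRegularEnergy U E) (i j : Fin n) : SmoothSlit U (metric E i j) :=
  (h.smooth.dDir h.isOpen j).dDir h.isOpen i

lemma smooth_spraySource (h : IsRegularEnergy U E) (j : Fin n) :
    SmoothSlit U fun x y => (∑ r, y r * dPos r (dDir j E) x y) - dPos j E x y :=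
  (SmoothSlit.sum fun r _ => (smoothSlit_coord r).mul
    ((h.smooth.dDir h.isOpen j).dPos h.isOpen r)).sub (h.smooth.dPos h.isOpen j)

lemma smooth_sprayCoeff (h : IsRegularEnergy U E) (i : Fin n) :
    SmoothSlit U (sprayCoeff E i) :=
  (smoothSlit_const _).mul (SmoothSlit.sum fun j _ =>
    (SmoothSlit.matrix_inv (h.smooth_metric · ·) h.det_ne_zero i j).mul (h.smooth_spraySource j))

lemma smooth_connCoeff (h : IsRegularEnergy U E) (i j : Fin n) :
    SmoothSlit U (connCoeff E i j) :=
  (h.smooth_sprayCoeff i).dDir h.isOpen j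

lemma smooth_berwaldCoeff (h : IsRegularEnergy U E) (i j k : Fin n) :
    SmoothSlit U (berwaldCoeff E i j k) :=
  (h.smooth_connCoeff i j).dDir h.isOpen k

lemma metric_comm (h : IsRegularEnergy U E) (hx : x ∈ U) (hy : y ≠ 0) (i j : Fin n) :
    metric E i j x y = metric E j i x y :=
  dDir_dDir_comm h.smooth h.isOpen hx hy i j

lemma homogeneous_metric (h : IsRegularEnergy U E) (i j : Fin n) :
    HomogeneousOn 0 U (metric E i j) :=
  (HomogeneousOn.dDir (k := 1) h.homogeneous j).dDir i

/-- The metric, hence its inverse, has degree 0, while both terms of the spray source have degree 2.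
-/
lemma homogeneous_sprayCoeff (h : IsRegularEnergy U E) (i : Fin n) :
    HomogeneousOn 2 U (sprayCoeff E i) := by
  intro x hx y hy c hc
  have hg : metricMatrix E x (c • y) = metricMatrix E x y := by
    ext i j
    exact (h.homogeneous_metric i j x hx y hy c hc).trans (by simp [metricMatrix])
  have h₁ (r j : Fin n) : dPos r (dDir j E) x (c • y) = c * dPos r (dDir j E) x y := by
    simpa using ((HomogeneousOn.dDir (k := 1) h.homogeneous j).dPos h.isOpen r) x hx y hy c hc
  simp only [sprayCoeff, hg, h₁, h.homogeneous.dPos h.isOpen _ x hx y hy c hc,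
    PiLp.smul_apply, smul_eq_mul]
  rw [mul_left_comm]
  congr 1
  rw [Finset.mul_sum]
  refine Finset.sum_congr rfl fun j _ => ?_
  rw [mul_left_comm, mul_sub (c ^ 2), Finset.mul_sum]
  congr 2
  exact Finset.sum_congr rfl fun r _ => by ring

/-- The contraction of the metric tensor with the canonical section. -/
lemma sum_metric_mul_coord (h : IsRegularEnergy U E) (hx : x ∈ U) (hy : y ≠ 0) (j : Fin n) :
    ∑ i, y i * metric E i j x y = dDir j E x y := by
  exact ((HomogeneousOn.dDir (k := 1) h.homogeneous j).euler (h.smooth.dDir h.isOpen j)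
    h.isOpen hx hy).trans (by simp)

/-- The equation `i_S d d_J E = -dE` that defines the canonical spray. -/
lemma spray_equation (h : IsRegularEnergy U E) (hx : x ∈ U) (hy : y ≠ 0) (k : Fin n) :
    2 * ∑ i, metric E k i x y * sprayCoeff E i x y =
      (∑ r, y r * dPos r (dDir k E) x y) - dPos k E x y := by
  set v : Fin n → ℝ := fun j => (∑ r, y r * dPos r (dDir j E) x y) - dPos j E x y with hv
  have hG (i : Fin n) : sprayCoeff E i x y = (1 / 2) * ((metricMatrix E x y)⁻¹.mulVec v) i := rfl
  have hm : (metricMatrix E x y).mulVec ((metricMatrix E x y)⁻¹.mulVec v) = v := by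
    rw [Matrix.mulVec_mulVec, Matrix.mul_nonsing_inv _ (h.det_ne_zero x hx y hy).isUnit,
      Matrix.one_mulVec]
  change _ = v k
  conv_rhs => rw [← hm]
  simp only [hG, Matrix.mulVec, dotProduct, metricMatrix, Matrix.of_apply]
  rw [Finset.mul_sum]
  exact Finset.sum_congr rfl fun i _ => by ring

/-- This is S E = 0: the energy is a first integral of the spray. It is the spray equation
contracted with y, simplified by Euler's theorem for ∂E/∂yⁱ and ∂E/∂xʳ. -/
lemma sum_dDir_mul_sprayCoeff (h : IsRegularEnergy U E) (hx : x ∈ U) (hy : y ≠ 0) :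
    2 * ∑ i, dDir i E x y * sprayCoeff E i x y = ∑ r, y r * dPos r E x y := by
  have h₁ : 2 * ∑ i, dDir i E x y * sprayCoeff E i x y =
      ∑ k, y k * (2 * ∑ i, metric E k i x y * sprayCoeff E i x y) := by
    simp only [← h.sum_metric_mul_coord hx hy, Finset.sum_mul, Finset.mul_sum]
    rw [Finset.sum_comm]
    exact Finset.sum_congr rfl fun _ _ => Finset.sum_congr rfl fun _ _ => by ring
  have h₂ (r : Fin n) : ∑ k, y k * dPos r (dDir k E) x y = 2 * dPos r E x y := by
    simpa [dDir_dPos_comm h.smooth h.isOpen hx hy] using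
      (h.homogeneous.dPos h.isOpen r).euler (h.smooth.dPos h.isOpen r) h.isOpen hx hy
  have h₃ : ∑ k, y k * ∑ r, y r * dPos r (dDir k E) x y = ∑ r, y r * (2 * dPos r E x y) := by
    simp only [← h₂, Finset.mul_sum]
    rw [Finset.sum_comm]
    exact Finset.sum_congr rfl fun _ _ => Finset.sum_congr rfl fun _ _ => by ring
  rw [h₁]
  simp only [h.spray_equation hx hy, mul_sub, Finset.sum_sub_distrib, h₃]
  rw [← Finset.sum_sub_distrib]
  exact Finset.sum_congr rfl fun r _ => by ring

/-- The canonical connection is conservative: the energy is constant along horizontal curves. -/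
lemma sum_dDir_mul_connCoeff (h : IsRegularEnergy U E) (hx : x ∈ U) (hy : y ≠ 0) (k : Fin n) :
    ∑ i, dDir i E x y * connCoeff E i k x y = dPos k E x y := by
  have hU := h.isOpen
  have hE (i : Fin n) := h.smooth.dDir hU i
  have hP (i : Fin n) := h.smooth.dPos hU i
  -- Differentiating S E = 0 in y^k yields 2 g_{ki} G^i + 2 (∂E/∂y^i) N^i_k on the left; the spray
  -- equation then eliminates the term in G^i.
  have h₁ : dDir k (fun x y => 2 * ∑ i, dDir i E x y * sprayCoeff E i x y) x y =
      dDir k (fun x y => ∑ r, y r * dPos r E x y) x y :=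
    dDir_congr (fun y hy => h.sum_dDir_mul_sprayCoeff hx hy) hy k
  rw [dDir_mul (smoothSlit_const 2)
      (SmoothSlit.sum fun i _ => (hE i).mul (h.smooth_sprayCoeff i)) hU hx hy,
    dDir_sum (fun i => (hE i).mul (h.smooth_sprayCoeff i)) hU hx hy,
    dDir_sum (fun r => (smoothSlit_coord r).mul (hP r)) hU hx hy] at h₁
  simp only [fun i => dDir_mul (hE i) (h.smooth_sprayCoeff i) hU hx hy k,
    fun r => dDir_mul (smoothSlit_coord r) (hP r) hU hx hy k, dDir_coord,
    Finset.sum_add_distrib, dDir_dPos_comm h.smooth hU hx hy] at h₁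
  have h₂ := h.spray_equation hx hy k
  have h₃ : dDir k (fun _ _ => (2 : ℝ)) x y = 0 := by simp [dDir]
  simp only [h₃, ite_mul, one_mul, zero_mul, Finset.sum_ite_eq',
    Finset.mem_univ, if_true] at h₁
  change 0 + 2 * (∑ i, metric E k i x y * sprayCoeff E i x y +
    ∑ i, dDir i E x y * connCoeff E i k x y) = _ at h₁
  linarith

/-- The horizontal Berwald differential of the metric is the contraction of the Berwald curvature
with the canonical section, lowered by the metric. -/
lemma horizMetric_eq (h : IsRegularEnergy U E) (hx : x ∈ U) (hy : y ≠ 0) (j k l : Fin n) :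
    horizMetric E j k l x y = ∑ i, dDir i E x y * berwaldCurv E i k j l x y := by
  have hU := h.isOpen
  have hE (i : Fin n) := h.smooth.dDir hU i
  -- Conservativity differentiated in y^l; `h₂` differentiates once more, in y^k.
  have h₁ {y : Coord n} (hy : y ≠ 0) : (∑ i, metric E l i x y * connCoeff E i j x y) +
      ∑ i, dDir i E x y * berwaldCoeff E i j l x y = dPos j (dDir l E) x y := by
    have := dDir_congr (φ := fun x y => ∑ i, dDir i E x y * connCoeff E i j x y)
      (fun y hy => h.sum_dDir_mul_connCoeff hx hy j) hy l
    rw [dDir_sum (fun i => (hE i).mul (h.smooth_connCoeff i j)) hU hx hy,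
      dDir_dPos_comm h.smooth hU hx hy] at this
    simp only [fun i => dDir_mul (hE i) (h.smooth_connCoeff i j) hU hx hy l,
      Finset.sum_add_distrib] at this
    exact this
  have h₂ := dDir_congr (φ := fun x y => (∑ i, metric E l i x y * connCoeff E i j x y) +
      ∑ i, dDir i E x y * berwaldCoeff E i j l x y) (fun y hy => h₁ hy) hy k
  have s₁ (i : Fin n) := (h.smooth_metric l i).mul (h.smooth_connCoeff i j)
  have s₂ (i : Fin n) := (hE i).mul (h.smooth_berwaldCoeff i j l)
  rw [dDir_add (SmoothSlit.sum fun i _ => s₁ i) (SmoothSlit.sum fun i _ => s₂ i) hU hx hy,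
    dDir_sum s₁ hU hx hy, dDir_sum s₂ hU hx hy, dDir_dPos_comm (hE l) hU hx hy] at h₂
  simp only [fun i => dDir_mul (h.smooth_metric l i) (h.smooth_connCoeff i j) hU hx hy k,
    fun i => dDir_mul (hE i) (h.smooth_berwaldCoeff i j l) hU hx hy k,
    Finset.sum_add_distrib] at h₂
  -- Total symmetry of ∂g/∂y, a third derivative of E, matches the remaining terms with those of
  -- ∇ʰg.
  have h₃ (r : Fin n) : dDir r (metric E k l) x y = dDir k (metric E l r) x y := by
    have := dDir_congr (φ := metric E l r) (ψ := metric E r l)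
      (fun y hy => h.metric_comm hx hy l r) hy k
    rw [this]
    exact dDir_dDir_comm (hE l) hU hx hy r k
  have e₁ : ∑ r, connCoeff E r j x y * dDir r (metric E k l) x y =
      ∑ r, dDir k (metric E l r) x y * connCoeff E r j x y :=
    Finset.sum_congr rfl fun r _ => by rw [h₃, mul_comm]
  have e₂ : ∑ r, berwaldCoeff E r j k x y * metric E r l x y =
      ∑ r, metric E l r x y * dDir k (connCoeff E r j) x y :=
    Finset.sum_congr rfl fun r _ => by rw [h.metric_comm hx hy, mul_comm]; rfl
  have e₃ : ∑ r, berwaldCoeff E r j l x y * metric E k r x y =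
      ∑ r, dDir k (dDir r E) x y * berwaldCoeff E r j l x y :=
    Finset.sum_congr rfl fun r _ => mul_comm _ _
  have e₄ : dPos j (metric E k l) x y = dPos j (dDir k (dDir l E)) x y := rfl
  rw [horizMetric, e₁, e₂, e₃, e₄, ← h₂]
  simp only [berwaldCurv]
  ring

lemma berwaldCurv_comm_right (h : IsRegularEnergy U E) (hx : x ∈ U) (hy : y ≠ 0)
    (i j k l : Fin n) : berwaldCurv E i j k l x y = berwaldCurv E i j l k x y :=
  dDir_congr (fun _ hy => dDir_dDir_comm (h.smooth_sprayCoeff i) h.isOpen hx hy l k) hy j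

/-- Together with `berwaldCurv_comm_right`, this transposition generates all permutations of the
three lower indices. -/
lemma berwaldCurv_comm_outer (h : IsRegularEnergy U E) (hx : x ∈ U) (hy : y ≠ 0)
    (i j k l : Fin n) : berwaldCurv E i j k l x y = berwaldCurv E i l k j x y :=
  dDir_dDir_comm (h.smooth_connCoeff i k) h.isOpen hx hy j l

/-- Euler's theorem for the Berwald coefficients, which have degree 0 as second derivatives of the
spray coefficients. -/
lemma sum_coord_mul_berwaldCurv (h : IsRegularEnergy U E) (hx : x ∈ U) (hy : y ≠ 0)
    (i k l : Fin n) : ∑ j, y j * berwaldCurv E i j k l x y = 0 := by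
  have hh : HomogeneousOn 0 U (berwaldCoeff E i k l) :=
    (HomogeneousOn.dDir (k := 1) (h.homogeneous_sprayCoeff i) k).dDir l
  exact (hh.euler (h.smooth_berwaldCoeff i k l) h.isOpen hx hy).trans (by simp)

/-- The squared length of the canonical section. -/
lemma sum_metric_mul_coord_mul_coord (h : IsRegularEnergy U E) (hx : x ∈ U) (hy : y ≠ 0) :
    ∑ a, ∑ b, metric E a b x y * y a * y b = 2 * E x y := by
  have h₁ : ∑ i, y i * dDir i E x y = 2 * E x y := by
    simpa using h.homogeneous.euler h.smooth h.isOpen hx hy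
  rw [← h₁, Finset.sum_comm]
  simp only [← h.sum_metric_mul_coord hx hy, Finset.mul_sum]
  exact Finset.sum_congr rfl fun _ _ => Finset.sum_congr rfl fun _ _ => by ring

end IsRegularEnergy

/-! ### Linear algebra in dimension two -/

/-- In dimension two, a symmetric tensor of order three that is annihilated by `y ≠ 0` is a
multiple of the cube of the covector `(-y¹, y⁰)`. -/
lemma exists_eq_mul_cube {y : Coord 2} (hy : y ≠ 0) {T : Fin 2 → Fin 2 → Fin 2 → ℝ}
    (hright : ∀ j k l, T j k l = T j l k) (houter : ∀ j k l, T j k l = T l k j)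
    (hT : ∀ k l, ∑ j, y j * T j k l = 0) :
    ∃ b : ℝ, ∀ j k l, T j k l = b * ![-y 1, y 0] j * ![-y 1, y 0] k * ![-y 1, y 0] l := by
  have h₁ := hT 0 0
  have h₂ := hT 0 1
  have h₃ := hT 1 1
  simp only [Fin.sum_univ_two] at h₁ h₂ h₃
  have e₁ : T 0 1 0 = T 1 0 0 := by rw [hright, houter]
  have e₂ : T 0 0 1 = T 1 0 0 := houter 0 0 1
  have e₃ : T 1 1 0 = T 0 1 1 := houter 1 1 0
  have e₄ : T 1 0 1 = T 0 1 1 := by rw [hright, e₃]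
  by_cases h0 : y 0 = 0
  · have hy1 : y 1 ≠ 0 := fun h1 => hy (by ext i; fin_cases i <;> simp [h0, h1])
    have t₁ : T 1 0 0 = 0 := by simpa [h0, hy1] using h₁
    have t₂ : T 0 1 1 = 0 := by simpa [h0, hy1, e₄] using h₂
    have t₃ : T 1 1 1 = 0 := by simpa [h0, hy1] using h₃
    -- Here only T 0 0 0 survives, and the covector is (-y 1, 0), so b = T 0 0 0 / (-y 1)³.
    refine ⟨-T 0 0 0 / y 1 ^ 3, ?_⟩
    have : T 0 0 0 = -T 0 0 0 / y 1 ^ 3 * -y 1 * -y 1 * -y 1 := by field_simp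
    simpa [Fin.forall_fin_two, h0, e₁, e₂, e₃, e₄, t₁, t₂, t₃] using this
  -- When y 0 ≠ 0, the contractions determine every component from T 1 1 1, which must equal b (y
  -- 0)³.
  · have t₂ : T 0 1 1 = -(y 1 * T 1 1 1) / y 0 := by field_simp; linarith
    have t₁ : T 1 0 0 = -(y 1 * T 0 1 1) / y 0 := by rw [e₂, e₄] at h₂; field_simp; linarith
    have t₀ : T 0 0 0 = -(y 1 * T 1 0 0) / y 0 := by field_simp; linarith
    refine ⟨T 1 1 1 / y 0 ^ 3, ?_⟩
    simp only [Fin.forall_fin_two, e₁, e₂, e₃, e₄, t₀, t₁, t₂, Matrix.cons_val_zero,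
      Matrix.cons_val_one]
    refine ⟨⟨⟨?_, ?_⟩, ?_, ?_⟩, ⟨?_, ?_⟩, ?_, ?_⟩ <;> field_simp

namespace IsRegularEnergy

variable {U : Set (Coord 2)} {E : Coord 2 → Coord 2 → ℝ} {x y : Coord 2}

lemma exists_berwaldCurv_eq (h : IsRegularEnergy U E) (hx : x ∈ U) (hy : y ≠ 0) :
    ∃ b : Fin 2 → ℝ, ∀ i j k l, berwaldCurv E i j k l x y =
      b i * ![-y 1, y 0] j * ![-y 1, y 0] k * ![-y 1, y 0] l := by
  choose b hb using fun i => exists_eq_mul_cube hy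
    (T := fun j k l => berwaldCurv E i j k l x y) (h.berwaldCurv_comm_right hx hy i)
    (h.berwaldCurv_comm_outer hx hy i) (h.sum_coord_mul_berwaldCurv hx hy i)
  exact ⟨b, hb⟩

end IsRegularEnergy

lemma exists_perp_ne_zero {y : Coord 2} (hy : y ≠ 0) : ∃ k : Fin 2, ![-y 1, y 0] k ≠ 0 := by
  by_contra! hk
  have h0 := hk 0
  have h1 := hk 1
  simp only [Matrix.cons_val_zero, Matrix.cons_val_one, neg_eq_zero] at h0 h1
  exact hy (by ext i; fin_cases i <;> simp [h0, h1])

/-- The kernel of the nonzero covector (-y 1, y 0) on the plane is the line spanned by y. -/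
lemma exists_eq_mul_of_perp {y : Coord 2} (hy : y ≠ 0) {b : Fin 2 → ℝ}
    (hb : b 0 * -y 1 + b 1 * y 0 = 0) : ∃ c : ℝ, ∀ i, b i = c * y i := by
  by_cases h0 : y 0 = 0
  · have hy1 : y 1 ≠ 0 := fun h1 => hy (by ext i; fin_cases i <;> simp [h0, h1])
    have hb0 : b 0 = 0 := by simpa [h0, hy1] using hb
    exact ⟨b 1 / y 1, by simp [Fin.forall_fin_two, h0, hb0, hy1]⟩
  · refine ⟨b 0 / y 0, ?_⟩
    simp only [Fin.forall_fin_two]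
    constructor <;> field_simp
    linarith

/-! ### Pointwise criteria on a surface -/

namespace IsRegularEnergy

variable {U : Set (Coord 2)} {E : Coord 2 → Coord 2 → ℝ} {x y : Coord 2}

/-- The Berwald curvature of a surface is traceless if and only if it takes its values in the line
spanned by the canonical section. -/
lemma berwaldTrace_eq_zero_iff (hy : y ≠ 0) {b : Fin 2 → ℝ}
    (hb : ∀ i j k l, berwaldCurv E i j k l x y =
      b i * ![-y 1, y 0] j * ![-y 1, y 0] k * ![-y 1, y 0] l) :
    (∀ k l, berwaldTrace E k l x y = 0) ↔ ∃ c : ℝ, ∀ i, b i = c * y i := by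
  have ht (k l : Fin 2) : berwaldTrace E k l x y =
      (b 0 * -y 1 + b 1 * y 0) * ![-y 1, y 0] k * ![-y 1, y 0] l := by
    simp only [berwaldTrace, hb, Fin.sum_univ_two, Matrix.cons_val_zero, Matrix.cons_val_one]
    ring
  constructor
  · intro h
    obtain ⟨k, hk⟩ := exists_perp_ne_zero hy
    have := h k k
    rw [ht] at this
    exact exists_eq_mul_of_perp hy (by simpa [hk] using this)
  · rintro ⟨c, hc⟩ k l
    rw [ht, hc, hc]
    ring

/-- The projection alters a vector only by a multiple of y, which the covector annihilates; the
three lower projections therefore have no effect. -/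
lemma projBerwaldCurv_eq {b : Fin 2 → ℝ}
    (hb : ∀ i j k l, berwaldCurv E i j k l x y =
      b i * ![-y 1, y 0] j * ![-y 1, y 0] k * ![-y 1, y 0] l) (i j k l : Fin 2) :
    projBerwaldCurv E i j k l x y = (∑ a, orthProj E i a x y * b a) *
      ![-y 1, y 0] j * ![-y 1, y 0] k * ![-y 1, y 0] l := by
  have hm (j : Fin 2) : ∑ a, ![-y 1, y 0] a * orthProj E a j x y = ![-y 1, y 0] j := by
    fin_cases j <;> simp [orthProj] <;> ring
  have h₁ : projBerwaldCurv E i j k l x y = (∑ a, orthProj E i a x y * b a) *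
      (∑ a, ![-y 1, y 0] a * orthProj E a j x y) * (∑ a, ![-y 1, y 0] a * orthProj E a k x y) *
      (∑ a, ![-y 1, y 0] a * orthProj E a l x y) := by
    simp only [projBerwaldCurv, hb, Fin.sum_univ_two]
    ring
  rw [h₁, hm, hm, hm]

lemma sum_orthProj_mul (b : Fin 2 → ℝ) (i : Fin 2) :
    ∑ a, orthProj E i a x y * b a = b i - (∑ j, (∑ a, metric E j a x y * y a) * b j) /
      (∑ a, ∑ b, metric E a b x y * y a * y b) * y i := by
  simp only [orthProj, sub_mul, ite_mul, one_mul, zero_mul, Finset.sum_sub_distrib,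
    Finset.sum_ite_eq, Finset.mem_univ, if_true]
  rw [Finset.sum_div, Finset.sum_mul]
  congr 1
  exact Finset.sum_congr rfl fun _ _ => by ring

lemma projBerwaldCurv_eq_zero_iff (h : IsRegularEnergy U E) (hx : x ∈ U) (hy : y ≠ 0)
    (hE : E x y ≠ 0) {b : Fin 2 → ℝ}
    (hb : ∀ i j k l, berwaldCurv E i j k l x y =
      b i * ![-y 1, y 0] j * ![-y 1, y 0] k * ![-y 1, y 0] l) :
    (∀ i j k l, projBerwaldCurv E i j k l x y = 0) ↔ ∃ c : ℝ, ∀ i, b i = c * y i := by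
  simp only [projBerwaldCurv_eq hb, sum_orthProj_mul]
  constructor
  · intro h
    obtain ⟨k, hk⟩ := exists_perp_ne_zero hy
    -- The factor is g(b, δ)/g(δ, δ): p(b) = 0 says that b equals its component along δ. Only the
    -- converse uses E ≠ 0.
    exact ⟨_, fun i => by simpa [hk, sub_eq_zero] using h i k k k⟩
  · rintro ⟨c, hc⟩ i j k l
    have hg := h.sum_metric_mul_coord_mul_coord hx hy
    have : ∑ j, (∑ a, metric E j a x y * y a) * b j =
        c * ∑ a, ∑ b, metric E a b x y * y a * y b := by
      simp only [hc, Finset.mul_sum, Finset.sum_mul]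
      exact Finset.sum_congr rfl fun _ _ => Finset.sum_congr rfl fun _ _ => by ring
    rw [this, hg, mul_div_cancel_right₀ _ (by simpa using hE), hc, sub_self]
    ring

lemma berwaldTrace_eq_zero_iff_projBerwaldCurv_eq_zero (h : IsRegularEnergy U E) (hx : x ∈ U)
    (hy : y ≠ 0) (hE : E x y ≠ 0) : (∀ k l, berwaldTrace E k l x y = 0) ↔
      ∀ i j k l, projBerwaldCurv E i j k l x y = 0 := by
  obtain ⟨b, hb⟩ := h.exists_berwaldCurv_eq hx hy
  rw [berwaldTrace_eq_zero_iff hy hb, h.projBerwaldCurv_eq_zero_iff hx hy hE hb]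

lemma berwaldCurv_eq_zero_iff (h : IsRegularEnergy U E) (hx : x ∈ U) (hy : y ≠ 0)
    (hE : E x y ≠ 0) : (∀ i j k l, berwaldCurv E i j k l x y = 0) ↔
      (∀ k l, berwaldTrace E k l x y = 0) ∧ ∀ j k l, landsberg E j k l x y = 0 := by
  constructor
  · intro hB
    exact ⟨fun k l => by simp [berwaldTrace, hB],
      fun j k l => by simp [landsberg, h.horizMetric_eq hx hy, hB]⟩
  · rintro ⟨ht, hP⟩
    obtain ⟨b, hb⟩ := h.exists_berwaldCurv_eq hx hy
    obtain ⟨c, hc⟩ := (berwaldTrace_eq_zero_iff hy hb).1 ht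
    obtain ⟨k, hk⟩ := exists_perp_ne_zero hy
    have h₁ : ∑ i, y i * dDir i E x y = 2 * E x y := by
      simpa using h.homogeneous.euler h.smooth h.isOpen hx hy
    -- One diagonal component with m_k ≠ 0 suffices: it equals -c E m_k³.
    have h₂ := hP k k k
    rw [landsberg, h.horizMetric_eq hx hy] at h₂
    simp only [hb, hc] at h₂
    have h₃ : ∑ i, dDir i E x y * (c * y i * ![-y 1, y 0] k * ![-y 1, y 0] k * ![-y 1, y 0] k) =
        (c * ![-y 1, y 0] k ^ 3) * ∑ i, y i * dDir i E x y := by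
      rw [Finset.mul_sum]
      exact Finset.sum_congr rfl fun i _ => by ring
    rw [h₃, h₁] at h₂
    have hc0 : c = 0 := by simpa [hk, hE] using h₂
    intro i j k l
    simp [hb, hc, hc0]

end IsRegularEnergy

/-! ### From the manifold to charts -/

section Charts

variable {n : ℕ} {M : Type*} [TopologicalSpace M] [ChartedSpace (Coord n) M]

lemma mdifferentiable_of_mem_maximalAtlas {e : OpenPartialHomeomorph M (Coord n)}
    (he : e ∈ IsManifold.maximalAtlas (𝓡 n) ∞ M) : e.MDifferentiable (𝓡 n) (𝓡 n) :=
  ⟨(contMDiffOn_of_mem_maximalAtlas he).mdifferentiableOn (by simp),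
    (contMDiffOn_symm_of_mem_maximalAtlas he).mdifferentiableOn (by simp)⟩

/-- The derivative of an inverse chart is injective, so the slit coordinate domain maps into the
slit tangent bundle. -/
lemma tangentMap_symm_ne_zero {e : OpenPartialHomeomorph M (Coord n)}
    (he : e ∈ IsManifold.maximalAtlas (𝓡 n) ∞ M) {x y : Coord n} (hx : x ∈ e.target)
    (hy : y ≠ 0) : (tangentMap (𝓡 n) (𝓡 n) e.symm ⟨x, y⟩).2 ≠ 0 := by
  have hinj := (mdifferentiable_of_mem_maximalAtlas he).symm.mfderiv_injective (x := x) hx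
  exact fun h => hy (hinj (h.trans (map_zero _).symm))

lemma contMDiff_tangentBundle_mk :
    ContMDiff 𝓘(ℝ, Coord n × Coord n) (𝓡 n).tangent ∞
      (fun p : Coord n × Coord n => (⟨p.1, p.2⟩ : TangentBundle (𝓡 n) (Coord n))) := by
  have h := contMDiff_tangentBundleModelSpaceHomeomorph_symm (I := 𝓡 n) (n := ∞)
  rw [modelWithCornersSelf_prod]
  exact h

/-- An inverse chart is smooth only on its target, so smoothness of its tangent map is obtained from
the version within that open set. -/
lemma tangentMap_symm_eq_tangentMapWithin {e : OpenPartialHomeomorph M (Coord n)}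
    (he : e ∈ IsManifold.maximalAtlas (𝓡 n) ∞ M) (p : TangentBundle (𝓡 n) (Coord n))
    (hp : p.1 ∈ e.target) : tangentMap (𝓡 n) (𝓡 n) e.symm p =
      tangentMapWithin (𝓡 n) (𝓡 n) e.symm e.target p :=
  (tangentMapWithin_eq_tangentMap (e.open_target.uniqueMDiffOn p.1 hp)
    ((mdifferentiable_of_mem_maximalAtlas he).mdifferentiableAt_symm hp)).symm

variable {F : TangentBundle (𝓡 n) M → ℝ}

lemma IsPositiveDefinite.localEnergy_ne_zero (hpos : IsPositiveDefinite F)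
    {e : OpenPartialHomeomorph M (Coord n)} (he : e ∈ IsManifold.maximalAtlas (𝓡 n) ∞ M)
    {x y : Coord n} (hx : x ∈ e.target) (hy : y ≠ 0) : localEnergy F e x y ≠ 0 := by
  have := hpos _ (tangentMap_symm_ne_zero he hx hy)
  unfold localEnergy
  positivity

variable [IsManifold (𝓡 n) ∞ M]

/-- The tangent map of the inverse of a chart is smooth in the coordinates `(x, y)`. -/
lemma contMDiffOn_tangentMap_symm {e : OpenPartialHomeomorph M (Coord n)}
    (he : e ∈ IsManifold.maximalAtlas (𝓡 n) ∞ M) :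
    ContMDiffOn 𝓘(ℝ, Coord n × Coord n) (𝓡 n).tangent ∞
      (fun p : Coord n × Coord n => tangentMap (𝓡 n) (𝓡 n) e.symm ⟨p.1, p.2⟩)
      (e.target ×ˢ Set.univ) := by
  have : IsManifold (𝓡 n) 1 M := IsManifold.of_le (n := ∞) (by simp)
  have hT : ContMDiffOn (𝓡 n).tangent (𝓡 n).tangent ∞
      (tangentMap (𝓡 n) (𝓡 n) e.symm) (Bundle.TotalSpace.proj ⁻¹' e.target) :=
    ((contMDiffOn_symm_of_mem_maximalAtlas he).contMDiffOn_tangentMapWithin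
      (m := ∞) (by simp) e.open_target.uniqueMDiffOn).congr
      fun p hp => tangentMap_symm_eq_tangentMapWithin he p hp
  exact ContMDiffOn.comp hT
    (contMDiff_tangentBundle_mk.contMDiffOn (s := e.target ×ˢ Set.univ)) fun p hp => hp.1

lemma IsFinslerFunction.isRegularEnergy (hF : IsFinslerFunction F)
    {e : OpenPartialHomeomorph M (Coord n)} (he : e ∈ IsManifold.maximalAtlas (𝓡 n) ∞ M) :
    IsRegularEnergy e.target (localEnergy F e) where
  isOpen := e.open_target
  smooth := by
    have h := hF.smooth.comp ((contMDiffOn_tangentMap_symm he).mono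
      (Set.prod_mono_right (Set.subset_univ ({0}ᶜ : Set (Coord n)))))
      fun p hp => tangentMap_symm_ne_zero he hp.1 hp.2
    exact contDiffOn_const.mul (h.contDiffOn.pow 2)
  homogeneous := by
    intro x hx y hy c hc
    have h : tangentMap (𝓡 n) (𝓡 n) e.symm ⟨x, c • y⟩ =
        ⟨e.symm x, c • mfderiv (𝓡 n) (𝓡 n) e.symm x y⟩ := by
      simp only [tangentMap]
      congr 1
      exact map_smul (mfderiv (𝓡 n) (𝓡 n) e.symm x) c y
    simp only [localEnergy]
    rw [h, hF.homogeneous _ _ c hc.le]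
    simp only [tangentMap]
    ring
  det_ne_zero := fun x hx y hy => hF.nondegenerate e he x hx y hy

end Charts

end Finsler

theorem mainTheorem8 {M : Type*} [TopologicalSpace M] [T2Space M] [SecondCountableTopology M]
    [ConnectedSpace M] [ChartedSpace (EuclideanSpace ℝ (Fin 2)) M] [IsManifold (𝓡 2) ∞ M]
    (F : TangentBundle (𝓡 2) M → ℝ) (hF : Finsler.IsFinslerFunction F)
    (hpos : Finsler.IsPositiveDefinite F) :
    (Finsler.IsWeaklyBerwald F ↔ Finsler.IsPBerwald F) ∧
      (Finsler.IsBerwald F ↔ Finsler.IsWeaklyBerwald F ∧ Finsler.HasVanishingLandsberg F) ∧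
      (Finsler.IsBerwald F ↔ Finsler.IsPBerwald F ∧ Finsler.HasVanishingLandsberg F) := by
  have h₁ : Finsler.IsWeaklyBerwald F ↔ Finsler.IsPBerwald F :=
    -- All conditions quantify over the same charts and points, so the pointwise criteria apply
    -- under the quantifiers.
    forall₂_congr fun e he => forall₂_congr fun x hx => forall₂_congr fun y hy =>
      (hF.isRegularEnergy he).berwaldTrace_eq_zero_iff_projBerwaldCurv_eq_zero hx hy
        (hpos.localEnergy_ne_zero he hx hy)
  have h₂ : Finsler.IsBerwald F ↔
      Finsler.IsWeaklyBerwald F ∧ Finsler.HasVanishingLandsberg F := by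
    have key {e : OpenPartialHomeomorph M (EuclideanSpace ℝ (Fin 2))}
        (he : e ∈ IsManifold.maximalAtlas (𝓡 2) ∞ M) {x y : Finsler.Coord 2}
        (hx : x ∈ e.target) (hy : y ≠ 0) :=
      (hF.isRegularEnergy he).berwaldCurv_eq_zero_iff hx hy (hpos.localEnergy_ne_zero he hx hy)
    exact ⟨fun h => ⟨fun e he x hx y hy => ((key he hx hy).1 (h e he x hx y hy)).1,
      fun e he x hx y hy => ((key he hx hy).1 (h e he x hx y hy)).2⟩,
      fun h e he x hx y hy => (key he hx hy).2 ⟨h.1 e he x hx y hy, h.2 e he x hx y hy⟩⟩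
  exact ⟨h₁, h₂, by rw [← h₁]; exact h₂⟩
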